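/- **Setting.** Let $F$ be a finite set of clauses. A solver state is $\langle\pi,\delta,\mathit{reason},\varphi\rangle$: the trail $\pi$ (an ordered set of literals), the decision levels $\delta$ (with $\delta(\ell)=\delta(\neg\ell)$, and $\infty$ for unassigned variables), the reasons of the literals, and the current clause set $\varphi$; for a finite set of literals, $\delta(S)=\max_{\ell\in S}\delta(\ell)$, with $\delta(\emptyset)=0$. Initially $\pi=\emptyset$, $\delta\equiv\infty$, there are no reasons, and $\varphi=F$. Both solvers below are non-deterministic transition systems with the CDCL steps: * *BCP*: if a clause $C\in\varphi$ has exactly one non-falsified literal $\ell$, and $\ell$ is unassigned, append $\ell$ to $\pi$ with $\mathit{reason}(\ell)=C$ and $\delta(\ell)=\delta(C\setminus\{\ell\})$; or report a clause $C\in\varphi$ all of whose literals are falsified as the conflict; * *decide*: if BCP can do neither, append an unassigned literal $\ell$ with no reason and $\delta(\ell)=\delta(\pi)+1$; * *analyze*: for a conflict $C$, learn a clause $D$, i.e. replace $\varphi$ by $\varphi\cup\{D\}$; * *backtrack*: unassign some literals; then append the unassigned literal $\ell$ of $D$ with reason $D$ and $\delta(\ell)=\delta(D\setminus\{\ell\})$.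 For a set $U$ of assigned literals, the first UIP of $C$ with respect to $U$ is obtained from $C$ by resolving, from right to left along $\pi$, with the reasons of literals of $U$ whose negations occur in the current clause, until exactly one literal of the clause is the negation of a literal of $U$. *Chronological backtracking (CB)*: for a conflict $C$ with $\delta(C)>0$, $D$ is the first UIP of $C$ with respect to the literals of level $\delta(C)$, and all literals of level above $\delta(D)-1$ are unassigned. *Graph backtracking ($\mathrm{GB}_\zeta$)*: the chunk $ck_d$ of a decision $d$ (an assigned literal without reason) is the set of literals on $\pi$ reachable from $d$ in the implication graph, whose edges lead from the (negated) other literals of $\mathit{reason}(\ell)$ to $\ell$. Let $\gamma(C)$ be the set of chunks that contain a literal of $C$ or its negation, and for a set of chunks $\Gamma$ let $\delta_\gamma(\Gamma)$ be the maximal level of their decisions. For a conflict $C$, a set $\Gamma^*$ of chunks is chosen that minimizes $\sum_{\ell\in\bigcup\Gamma}\zeta(\ell)$ among all sets of chunks $\Gamma$ with $|\Gamma\cap\gamma(C)|=1$ for which the first UIP of $C$ with respect to $\bigcup\Gamma$ is not in $\varphi$ or $\delta_\gamma(\Gamma\cap\gamma(C))=\delta(C)$. Then $D$ is the first UIP of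 $C$ with respect to $\bigcup\Gamma^*$; the literals in $\bigcup\Gamma^*$ are unassigned, and the levels of the remaining literals are recomputed from left to right (number of preceding decisions plus one for a decision, $\delta(\mathit{reason}(\ell)\setminus\{\ell\})$ for an implied literal $\ell$). **Theorem (GB simulates CB).** Let $\zeta_{\mathrm{CB}}(\ell)=-1$ if $\delta(\ell)\ge\delta(C)$ and $\zeta_{\mathrm{CB}}(\ell)=1$ otherwise, where $C$ is the current conflict. Then for every $F$ the sequences of solver states that occur in executions of $\mathrm{GB}_{\zeta_{\mathrm{CB}}}$ on $F$ are exactly those that occur in executions of $\mathrm{CB}$ on $F$; in particular, the two solvers reach the same solver states. Moreover, for every conflict $C$ with $\delta(C)>0$ that is encountered in an execution of $\mathrm{GB}_{\zeta_{\mathrm{CB}}}$, there is exactly one optimal chunk set $\Gamma^*$; it consists of the chunks whose decision has level at least $\delta(C)$, it satisfies $\bigcup\Gamma^*=\{\ell\in\pi:\delta(\ell)\ge\delta(C)\}$, and the first UIP of $C$ with respect to $\bigcup\Gamma^*$ is the clause learned by $\mathrm{CB}$. -/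

import Mathlib

namespace SAT

/-- A literal over the variables `V`: `(v, true)` is `v` and `(v, false)` is its negation. -/
abbrev Lit (V : Type*) := V × Bool

/-- The complementary literal. -/
def Lit.neg {V : Type*} (l : Lit V) : Lit V := (l.1, !l.2)

/-- A clause is a finite set of literals, read disjunctively. -/
abbrev Clause (V : Type*) := Finset (Lit V)

/-- A formula in conjunctive normal form is a finite set of clauses. -/
abbrev CNF (V : Type*) := Finset (Clause V)

/-- A solver state `⟨π, δ, reason, φ⟩`. The trail `π` is ordered, with the oldest literal first.
The level `δ` is stored per variable, so that a literal and its negation have the same level;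
`⊤` is the level of unassigned variables. `reason l = none` means that there is no reason. -/
@[ext]
structure State (V : Type*) where
  trail : List (Lit V)
  level : V → ℕ∞
  reason : Lit V → Option (Clause V)
  clauses : CNF V

namespace State

variable {V : Type*} [DecidableEq V]

/-- Nothing is assigned and the clause set is the input formula. -/
def init (F : CNF V) : State V where
  trail := []
  level := fun _ => ⊤
  reason := fun _ => none
  clauses := F

def Unassigned (s : State V) (l : Lit V) : Prop := l ∉ s.trail ∧ l.neg ∉ s.trail

/-- The literals of `C` that are not falsified by the trail. -/
def rest (s : State V) (C : Clause V) : Clause V := C.filter fun c => c.neg ∉ s.trail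

def Falsified (s : State V) (C : Clause V) : Prop := s.rest C = ∅

def UnitIn (s : State V) (C : Clause V) (l : Lit V) : Prop := s.rest C = {l}

/-- The decision level of a literal. -/
def lev (s : State V) (l : Lit V) : ℕ∞ := s.level l.1

/-- The decision level of a finite set of literals: the maximum, which is `0` for the empty set. -/
noncomputable def levSet (s : State V) (S : Finset (Lit V)) : ℕ∞ := S.sup s.lev

/-- Append `l` to the trail, with reason `r` and level `n`. -/
def assign (s : State V) (l : Lit V) (r : Option (Clause V)) (n : ℕ∞) : State V where
  trail := s.trail ++ [l]
  level := Function.update s.level l.1 n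
  reason := Function.update s.reason l r
  clauses := s.clauses

/-- `l` is assigned because the clause `C` implies it. -/
noncomputable def imply (s : State V) (l : Lit V) (C : Clause V) : State V :=
  s.assign l (some C) (s.levSet (C.erase l))

/-- `l` is assigned as a new decision. -/
noncomputable def decideLit (s : State V) (l : Lit V) : State V :=
  s.assign l none (s.levSet s.trail.toFinset + 1)

/-- Add a clause to the clause set. -/
def learn (s : State V) (D : Clause V) : State V := { s with clauses := insert D s.clauses }

/-- No clause is falsified and no unassigned literal is implied: unit propagation has ended
without a conflict. -/
def Saturated (s : State V) : Prop :=
  ∀ C ∈ s.clauses, ¬ s.Falsified C ∧ ∀ l, s.Unassigned l → ¬ s.UnitIn C l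

/-! ### Conflict analysis -/

/-- Binary resolution of `D` (containing `¬ l`) with the reason `C` of `l`. -/
def resolve (D : Clause V) (l : Lit V) : Option (Clause V) → Clause V
  | none => D
  | some C => D.erase l.neg ∪ C.erase l

/-- First-UIP search. `U` is the set of assigned literals that is relevant for the analysis; the
list holds the trail literals that are still to be visited, the most recent one first. As soon as
exactly one literal of the current clause `D` is the negation of a literal in `U`, the clause `D`
is returned; otherwise the most recent literal in `U` that occurs negated in `D` is resolved
away. -/
def uipLoop (reason : Lit V → Option (Clause V)) (U : Finset (Lit V)) :
    List (Lit V) → Clause V → Clause V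
  | [], D => D
  | l :: ls, D =>
    if (D.filter fun c => c.neg ∈ U).card = 1 then D
    else if l.neg ∈ D ∧ l ∈ U then uipLoop reason U ls (resolve D l (reason l))
    else uipLoop reason U ls D

def uip (s : State V) (U : Finset (Lit V)) (C : Clause V) : Clause V :=
  uipLoop s.reason U s.trail.reverse C

/-! ### Chronological backtracking -/

/-- The usual first UIP of a conflict `C`: the first clause with a single literal at the highest
decision level of the conflict. -/
noncomputable def uipLevel (s : State V) (C : Clause V) : Clause V :=
  s.uip (s.trail.toFinset.filter fun l => s.lev l = s.levSet C) C

/-- Backtrack to level `b`: unassign all literals above level `b`. -/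
noncomputable def undoLevel (s : State V) (b : ℕ∞) : State V where
  trail := s.trail.filter fun l => s.lev l ≤ b
  level := fun v => if ∃ l ∈ s.trail, l.1 = v ∧ b < s.lev l then ⊤ else s.level v
  reason := fun l => if l ∈ s.trail ∧ b < s.lev l then none else s.reason l
  clauses := s.clauses

/-! ### Graph backtracking -/

/-- The decision literals on the trail. -/
def decisions (s : State V) : Finset (Lit V) := s.trail.toFinset.filter fun l => s.reason l = none

/-- The edges of the implication graph, from the literals of a reason to the implied literal. -/
def Edge (s : State V) (l' l : Lit V) : Prop :=
  l' ∈ s.trail ∧ l ∈ s.trail ∧ ∃ C, s.reason l = some C ∧ l'.neg ∈ C.erase l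

open Classical in
/-- The chunk of a decision `d`: all literals reachable from `d` in the implication graph.
As `d` is the only decision in it, a chunk is referred to by its decision, and a set of chunks is a
finite set of decisions. -/
noncomputable def chunk (s : State V) (d : Lit V) : Finset (Lit V) :=
  s.trail.toFinset.filter fun l => Relation.ReflTransGen s.Edge d l

/-- `γ(l)`: the chunks that contain `l` or its negation. -/
noncomputable def chunksOf (s : State V) (l : Lit V) : Finset (Lit V) :=
  s.decisions.filter fun d => l ∈ s.chunk d ∨ l.neg ∈ s.chunk d

/-- `γ(C)`: the chunks of the literals of a clause. -/
noncomputable def chunksOfClause (s : State V) (C : Clause V) : Finset (Lit V) :=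
  C.biUnion s.chunksOf

/-- The union of a set of chunks. -/
noncomputable def chunkUnion (s : State V) (G : Finset (Lit V)) : Finset (Lit V) :=
  G.biUnion s.chunk

/-- The first UIP with respect to a set of chunks. -/
noncomputable def uipChunks (s : State V) (G : Finset (Lit V)) (C : Clause V) : Clause V :=
  s.uip (s.chunkUnion G) C

/-- Terminating backtrack candidates for the conflict `C`. The level of a chunk is the level of its
decision. -/
def IsCandidate (s : State V) (C : Clause V) (G : Finset (Lit V)) : Prop :=
  G ⊆ s.decisions ∧
  (G ∩ s.chunksOfClause C).card = 1 ∧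
  (s.uipChunks G C ∉ s.clauses ∨ s.levSet (G ∩ s.chunksOfClause C) = s.levSet C)

/-- A lightest candidate for the weight function `z`. -/
def IsOptimal (z : Lit V → ℝ) (s : State V) (C : Clause V) (G : Finset (Lit V)) : Prop :=
  s.IsCandidate C G ∧
  ∀ G', s.IsCandidate C G' → ∑ l ∈ s.chunkUnion G, z l ≤ ∑ l ∈ s.chunkUnion G', z l

/-- Recompute levels from left to right along a list of assigned literals, given the number `k` of
decisions to the left of the list: the level of a decision is the number of preceding decisions plus
one, and the level of an implied literal is the maximal level of the other literals in its
reason. -/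
noncomputable def relevel (reason : Lit V → Option (Clause V)) :
    List (Lit V) → ℕ → (V → ℕ∞) → (V → ℕ∞)
  | [], _, lv => lv
  | l :: ls, k, lv =>
    match reason l with
    | none => relevel reason ls (k + 1) (Function.update lv l.1 ((k : ℕ∞) + 1))
    | some C => relevel reason ls k (Function.update lv l.1 ((C.erase l).sup fun c => lv c.1))

/-- Undo a set of chunks: unassign all their literals and recompute the levels of the others. -/
noncomputable def undoChunks (s : State V) (G : Finset (Lit V)) : State V :=
  let U := s.chunkUnion G
  let kept := s.trail.filter fun l => l ∉ U
  { trail := kept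
    level := relevel s.reason kept 0 fun v => if ∃ l ∈ U, l.1 = v then ⊤ else s.level v
    reason := fun l => if l ∈ U then none else s.reason l
    clauses := s.clauses }

end State

/-! ### The transition systems -/

/-- The control location of a solver. `conflict C`: propagation has reported the conflict `C`.
`analyzed b D`: the clause `D` has been learned, and `b` describes what is to be undone.
`undone D`: the backtracking is done, and `D` has to imply its unassigned literal. -/
inductive Phase (V : Type*) (β : Type*) where
  | search : Phase V β
  | conflict (C : Clause V) : Phase V β
  | analyzed (b : β) (D : Clause V) : Phase V β
  | undone (D : Clause V) : Phase V β

/-- A solver state together with a control location. -/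
structure Config (V : Type*) (β : Type*) where
  state : State V
  phase : Phase V β

/-- A conflict repair scheme. `analysis s C b D`: in the state `s` with conflict `C`, conflict
analysis may learn `D` and choose `b` for backtracking; `undo` performs the backtracking. -/
structure Scheme (V : Type*) (β : Type*) where
  analysis : State V → Clause V → β → Clause V → Prop
  undo : State V → β → State V

variable {V : Type*} [DecidableEq V] {β : Type*}

/-- One step of CDCL with the given repair scheme. The order in which unit propagation finds
implications and conflicts is not determined; a decision is only made after propagation has ended
without a conflict. -/
inductive Step (A : Scheme V β) : Config V β → Config V β → Prop
  | decide (s : State V) (l : Lit V) (hs : s.Saturated) (hl : s.Unassigned l) :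
      Step A ⟨s, .search⟩ ⟨s.decideLit l, .search⟩
  | propagate (s : State V) (C : Clause V) (l : Lit V) (hC : C ∈ s.clauses)
      (hl : s.Unassigned l) (hu : s.UnitIn C l) :
      Step A ⟨s, .search⟩ ⟨s.imply l C, .search⟩
  | conflict (s : State V) (C : Clause V) (hC : C ∈ s.clauses) (hf : s.Falsified C) :
      Step A ⟨s, .search⟩ ⟨s, .conflict C⟩
  | analyze (s : State V) (C D : Clause V) (b : β) (h : A.analysis s C b D) :
      Step A ⟨s, .conflict C⟩ ⟨s.learn D, .analyzed b D⟩
  | backtrack (s : State V) (D : Clause V) (b : β) :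
      Step A ⟨s, .analyzed b D⟩ ⟨A.undo s b, .undone D⟩
  | flip (s : State V) (D : Clause V) (l : Lit V) (hD : l ∈ D) (hl : s.Unassigned l) :
      Step A ⟨s, .undone D⟩ ⟨s.imply l D, .search⟩

/-- Chronological backtracking: unless the conflict is at level `0`, learn the usual first UIP
`D`, and backtrack to the highest level in `D` minus one. -/
noncomputable def CB : Scheme V ℕ∞ where
  analysis s C b D := 0 < s.levSet C ∧ D = s.uipLevel C ∧ b = s.levSet D - 1
  undo s b := s.undoLevel b

/-- Graph backtracking for a weight function that may depend on the state and on the conflict: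
select a lightest candidate `G`, learn the first UIP with respect to `G`, and undo `G`.
(If the conflict belongs to no chunk, then there is no candidate, and no step is possible.) -/
noncomputable def GB (z : State V → Clause V → Lit V → ℝ) : Scheme V (Finset (Lit V)) where
  analysis s C G D := s.IsOptimal (z s C) C G ∧ D = s.uipChunks G C
  undo s G := s.undoChunks G

/-- The weight that makes graph backtracking chronological. -/
noncomputable def zetaCB (s : State V) (C : Clause V) (l : Lit V) : ℝ :=
  if s.levSet C ≤ s.lev l then -1 else 1

/-- The configuration in which the solver starts on `F`. -/
def start (V : Type*) (β : Type*) [DecidableEq V] (F : CNF V) : Config V β :=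
  ⟨State.init F, .search⟩

/-- `c` is encountered in some execution on `F`. -/
def ReachableConfig (A : Scheme V β) (F : CNF V) (c : Config V β) : Prop :=
  Relation.ReflTransGen (Step A) (start V β F) c

/-- The solver state `s` is encountered in some execution on `F`. -/
def Reachable (A : Scheme V β) (F : CNF V) (s : State V) : Prop :=
  ∃ p, ReachableConfig A F ⟨s, p⟩

/-- `t` is the sequence of solver states of some finite execution on `F`, from its start. -/
def IsTrace (A : Scheme V β) (F : CNF V) (t : List (State V)) : Prop :=
  ∃ cs : List (Config V β), (start V β F :: cs).IsChain (Step A) ∧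
    t = (start V β F :: cs).map Config.state

end SAT

namespace SAT

namespace State

variable {V : Type*} [DecidableEq V]

/-! ### Well-levelled trails -/

/-! An implied literal has the maximal level of the other literals in its reason, so levels never
drop along edges of the implication graph, and a literal of level `n > 0` can be traced back to the
unique decision of level `n`. Hence, for `m > 0`, the chunks of the decisions of level at least `m`
together cover exactly the literals of level at least `m` (`chunkUnion_decisionsFrom`).

Let `A` be the set of trail literals of level at least `δ(C)`. A union `U` of chunks weighs `|U \ A|
- |U ∩ A| ≥ -|A|`, with equality only for `U = A`. The decisions of level at least `δ(C)` attain the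
bound and form a candidate, and a set of chunks is determined by its union, so the optimum is unique
(`isOptimal_iff`).

Analysis at level `δ(C)` never meets a literal of higher level, so `A` and the literals of level
exactly `δ(C)` yield the same first UIP (`uipLoop_spec`). Its level is `δ(C)`, so both solvers
unassign `A`; recomputing levels changes nothing, as the remaining trail is still well-levelled
(`undoChunks_decisionsFrom`). The solvers therefore run in lockstep on identical states. Implied
literals may appear out of level order on the trail; only the decisions are ordered by level. -/

/-- `WellLeveled lv r t k`: the trail `t` has `k` decisions, which have the levels `1, …, k` in this
order, and each implied literal is implied by earlier literals and
has their maximal level. -/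
inductive WellLeveled (lv : V → ℕ∞) (r : Lit V → Option (Clause V)) : List (Lit V) → ℕ → Prop
  | nil : WellLeveled lv r [] 0
  | decide {t : List (Lit V)} {k : ℕ} (l : Lit V) (h : WellLeveled lv r t k)
      (hr : r l = none) (hlev : lv l.1 = (k : ℕ∞) + 1) :
      WellLeveled lv r (t ++ [l]) (k + 1)
  | imply {t : List (Lit V)} {k : ℕ} (l : Lit V) (C : Clause V) (h : WellLeveled lv r t k)
      (hr : r l = some C) (hC : ∀ c ∈ C.erase l, c.neg ∈ t)
      (hlev : lv l.1 = (C.erase l).sup fun c => lv c.1) :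
      WellLeveled lv r (t ++ [l]) k

namespace WellLeveled

variable {lv lv' : V → ℕ∞} {r r' : Lit V → Option (Clause V)} {t : List (Lit V)} {k : ℕ}

theorem congr (h : WellLeveled lv r t k) (hlv : ∀ x ∈ t, lv' x.1 = lv x.1)
    (hr : ∀ x ∈ t, r' x = r x) : WellLeveled lv' r' t k := by
  induction h with
  | nil => exact .nil
  | decide l h hrl hlev ih =>
    simp only [List.mem_append, List.mem_singleton] at hlv hr
    refine .decide l (ih (fun x hx => hlv x (.inl hx)) fun x hx => hr x (.inl hx)) ?_ ?_
    · rw [hr l (.inr rfl), hrl]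
    · rw [hlv l (.inr rfl), hlev]
  | imply l C h hrl hC hlev ih =>
    simp only [List.mem_append, List.mem_singleton] at hlv hr
    refine .imply l C (ih (fun x hx => hlv x (.inl hx)) fun x hx => hr x (.inl hx)) ?_ hC ?_
    · rw [hr l (.inr rfl), hrl]
    · rw [hlv l (.inr rfl), hlev]
      exact Finset.sup_congr rfl fun c hc => (hlv _ (.inl (hC c hc))).symm

theorem level_le (h : WellLeveled lv r t k) : ∀ x ∈ t, lv x.1 ≤ k := by
  induction h with
  | nil => simp
  | decide l h hrl hlev ih =>
    simp only [List.mem_append, List.mem_singleton]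
    rintro x (hx | rfl)
    · exact (ih x hx).trans (by exact_mod_cast Nat.le_succ _)
    · rw [hlev]; push_cast; exact le_rfl
  | imply l C h hrl hC hlev ih =>
    simp only [List.mem_append, List.mem_singleton]
    rintro x (hx | rfl)
    · exact ih x hx
    · rw [hlev]
      exact Finset.sup_le fun c hc => ih c.neg (hC c hc)

theorem level_pos_of_decision (h : WellLeveled lv r t k) :
    ∀ x ∈ t, r x = none → 0 < lv x.1 := by
  induction h with
  | nil => simp
  | decide l h hrl hlev ih =>
    simp only [List.mem_append, List.mem_singleton]
    rintro x (hx | rfl) hr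
    · exact ih x hx hr
    · rw [hlev]; exact_mod_cast Nat.succ_pos _
  | imply l C h hrl hC hlev ih =>
    simp only [List.mem_append, List.mem_singleton]
    rintro x (hx | rfl) hr
    · exact ih x hx hr
    · simp [hrl] at hr

theorem decision_unique (h : WellLeveled lv r t k) :
    ∀ x ∈ t, ∀ y ∈ t, r x = none → r y = none → lv x.1 = lv y.1 → x = y := by
  induction h with
  | nil => simp
  | @decide t k l h hrl hlev ih =>
    have key : ∀ x ∈ t, lv x.1 ≠ lv l.1 := by
      intro x hx he
      have := h.level_le x hx
      rw [he, hlev] at this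
      exact absurd (by exact_mod_cast this) (Nat.not_succ_le_self k)
    simp only [List.mem_append, List.mem_singleton]
    rintro x (hx | rfl) y (hy | rfl) hrx hry hxy
    · exact ih x hx y hy hrx hry hxy
    · exact absurd hxy (key x hx)
    · exact absurd hxy.symm (key y hy)
    · rfl
  | imply l C h hrl hC hlev ih =>
    simp only [List.mem_append, List.mem_singleton]
    rintro x (hx | rfl) y (hy | rfl) hrx hry hxy
    · exact ih x hx y hy hrx hry hxy
    · simp [hrl] at hry
    · simp [hrl] at hrx
    · rfl

theorem reason_spec (h : WellLeveled lv r t k) :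
    ∀ x ∈ t, ∀ C, r x = some C →
      (∀ c ∈ C.erase x, c.neg ∈ t) ∧ lv x.1 = (C.erase x).sup fun c => lv c.1 := by
  induction h with
  | nil => simp
  | decide l h hrl hlev ih =>
    simp only [List.mem_append, List.mem_singleton]
    rintro x (hx | rfl) C hr
    · exact ⟨fun c hc => .inl ((ih x hx C hr).1 c hc), (ih x hx C hr).2⟩
    · simp [hrl] at hr
  | imply l C h hrl hC hlev ih =>
    simp only [List.mem_append, List.mem_singleton]
    rintro x (hx | rfl) C' hr
    · exact ⟨fun c hc => .inl ((ih x hx C' hr).1 c hc), (ih x hx C' hr).2⟩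
    · obtain rfl : C = C' := by simpa [hrl] using hr
      exact ⟨fun c hc => .inl (hC c hc), hlev⟩

/-- Makes `δ(π) + 1` the level `k + 1` that the next decision must have. -/
theorem sup_level (h : WellLeveled lv r t k) : (t.toFinset.sup fun c => lv c.1) = k := by
  induction h with
  | nil => simp
  | @decide t k l h hrl hlev ih =>
    rw [List.toFinset_append, Finset.sup_union, ih]
    simp only [List.toFinset_cons, List.toFinset_nil, insert_empty_eq, Finset.sup_singleton, hlev]
    push_cast
    exact sup_of_le_right le_self_add
  | @imply t k l C h hrl hC hlev ih =>
    rw [List.toFinset_append, Finset.sup_union, ih]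
    simp only [List.toFinset_cons, List.toFinset_nil, insert_empty_eq, Finset.sup_singleton, hlev]
    exact sup_of_le_left (Finset.sup_le fun c hc => h.level_le c.neg (hC c hc))

/-- Dropping all literals above some level keeps a trail well-levelled. -/
theorem filter_level (h : WellLeveled lv r t k) (b : ℕ∞) :
    ∃ k', WellLeveled lv r (t.filter fun l => lv l.1 ≤ b) k' ∧ ((k : ℕ∞) ≤ b → k' = k) := by
  induction h with
  | nil => exact ⟨0, .nil, fun _ => rfl⟩
  | @decide t k l h hrl hlev ih =>
    obtain ⟨k', hk', he⟩ := ih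
    rw [List.filter_append]
    -- If this decision survives, so do all `k` earlier ones, whose levels are smaller; its level is
    -- thus still one more than the number of preceding decisions. The clause `k ≤ b → k' = k`
    -- carries this through the induction.
    by_cases hb : (k : ℕ∞) + 1 ≤ b
    · obtain rfl := he (le_self_add.trans hb)
      refine ⟨k' + 1, ?_, fun _ => rfl⟩
      have : [l].filter (fun l => lv l.1 ≤ b) = [l] := by simp [hlev, hb]
      rw [this]
      exact .decide l hk' hrl hlev
    · refine ⟨k', ?_, fun hb' => absurd (by exact_mod_cast hb') hb⟩
      have : [l].filter (fun l => lv l.1 ≤ b) = [] := by simp [hlev, hb]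
      rwa [this, List.append_nil]
  | @imply t k l C h hrl hC hlev ih =>
    obtain ⟨k', hk', he⟩ := ih
    rw [List.filter_append]
    refine ⟨k', ?_, he⟩
    by_cases hb : lv l.1 ≤ b
    · have : [l].filter (fun l => lv l.1 ≤ b) = [l] := by simp [hb]
      rw [this]
      refine .imply l C hk' hrl (fun c hc => ?_) hlev
      simp only [List.mem_filter, decide_eq_true_eq]
      refine ⟨hC c hc, le_trans ?_ hb⟩
      exact (Finset.le_sup (f := fun c : Lit V => lv c.1) hc).trans hlev.ge
    · have : [l].filter (fun l => lv l.1 ≤ b) = [] := by simp [hb]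
      rwa [this, List.append_nil]

/-- Each update writes the value already present. The suffix `u` is needed because `WellLeveled`
grows on the right while `relevel` consumes from the left. -/
theorem relevel_append (h : WellLeveled lv r t k) (u : List (Lit V)) :
    relevel r (t ++ u) 0 lv = relevel r u k lv := by
  induction h generalizing u with
  | nil => rfl
  | decide l h hrl hlev ih =>
    rw [List.append_assoc, ih, List.singleton_append, relevel, hrl]
    simp only [← hlev, Function.update_eq_self]
  | imply l C h hrl hC hlev ih =>
    rw [List.append_assoc, ih, List.singleton_append, relevel, hrl]
    simp only [← hlev, Function.update_eq_self]

theorem relevel_eq (h : WellLeveled lv r t k) : relevel r t 0 lv = lv := by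
  simpa [relevel] using h.relevel_append []

/-- Every literal of positive level is reachable from the decision of its level. -/
theorem exists_decision {s : State V} (h : WellLeveled s.level s.reason t k)
    (ht : ∀ x ∈ t, x ∈ s.trail) :
    ∀ x ∈ t, 0 < s.lev x →
      ∃ d ∈ t, s.reason d = none ∧ s.lev d = s.lev x ∧ Relation.ReflTransGen s.Edge d x := by
  induction h with
  | nil => simp
  | decide l h hrl hlev ih =>
    simp only [List.mem_append, List.mem_singleton] at ht ⊢
    rintro x (hx | rfl) h0
    · obtain ⟨d, hd, h'⟩ := ih (fun y hy => ht y (.inl hy)) x hx h0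
      exact ⟨d, .inl hd, h'⟩
    · exact ⟨x, .inr rfl, hrl, rfl, .refl⟩
  | imply l C h hrl hC hlev ih =>
    simp only [List.mem_append, List.mem_singleton] at ht ⊢
    rintro x (hx | rfl) h0
    · obtain ⟨d, hd, h'⟩ := ih (fun y hy => ht y (.inl hy)) x hx h0
      exact ⟨d, .inl hd, h'⟩
    · have hne : (C.erase x).Nonempty := by
        rw [Finset.nonempty_iff_ne_empty]
        intro he
        rw [lev, hlev, he] at h0
        simp at h0
      obtain ⟨c, hc, hce⟩ := Finset.exists_mem_eq_sup _ hne fun c : Lit V => s.level c.1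
      have hcx : s.lev c.neg = s.lev x := (hlev.trans hce).symm
      obtain ⟨d, hd, hrd, hld, hdc⟩ := ih (fun y hy => ht y (.inl hy)) _ (hC c hc) (hcx ▸ h0)
      refine ⟨d, .inl hd, hrd, hld.trans hcx, hdc.tail ⟨ht _ (.inl (hC c hc)), ht x (.inr rfl), C,
        hrl, ?_⟩⟩
      simpa [Lit.neg] using hc

/-- First-UIP search at the highest level `m` of a falsified clause. The set `U` of relevant
literals only matters up to level `m`, where it has to consist of the literals of level `m`. -/
theorem uipLoop_spec {T : List (Lit V)} {m : ℕ∞} (hm : 0 < m) {U U' : Finset (Lit V)}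
    (hU : ∀ x ∈ T, lv x.1 ≤ m → (x ∈ U ↔ lv x.1 = m))
    (hU' : ∀ x ∈ T, lv x.1 ≤ m → (x ∈ U' ↔ lv x.1 = m))
    (h : WellLeveled lv r t k) (hT : ∀ x ∈ t, x ∈ T) (D : Clause V)
    (hD : ∀ c ∈ D, c.neg ∈ T ∧ lv c.1 ≤ m ∧ (lv c.1 = m → c.neg ∈ t))
    (hex : ∃ c ∈ D, lv c.1 = m) :
    uipLoop r U' t.reverse D = uipLoop r U t.reverse D ∧
      (∀ c ∈ uipLoop r U t.reverse D, c.neg ∈ T ∧ lv c.1 ≤ m) ∧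
      ((uipLoop r U t.reverse D).filter fun c => lv c.1 = m).card = 1 := by
  -- `T` is the whole trail and `t` the part still to be visited. Throughout the search, all
  -- literals of `D` at level `m` have their negations in `t`, and there is at least one of them.
  induction h generalizing D with
  | nil =>
    obtain ⟨c, hc, hcm⟩ := hex
    simpa using (hD c hc).2.2 hcm
  | @decide t k l h hrl hlev ih =>
    have hf : (D.filter fun c => c.neg ∈ U) = D.filter fun c => lv c.1 = m :=
      Finset.filter_congr fun c hc => hU _ (hD c hc).1 (hD c hc).2.1
    have hf' : (D.filter fun c => c.neg ∈ U') = D.filter fun c => lv c.1 = m :=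
      Finset.filter_congr fun c hc => hU' _ (hD c hc).1 (hD c hc).2.1
    rw [List.reverse_append, List.reverse_singleton, List.singleton_append, uipLoop, uipLoop, hf,
      hf']
    by_cases h1 : (D.filter fun c => lv c.1 = m).card = 1
    · simp only [h1, if_true, and_true, true_and]
      exact fun c hc => ⟨(hD c hc).1, (hD c hc).2.1⟩
    -- A decision is never resolved away: everything before it has smaller level, so if it were the
    -- literal at level `m`, it would be the only one and the search would have stopped.
    have hnot : ¬ (l.neg ∈ D ∧ lv l.1 = m) := by
      rintro ⟨hlD, hlm⟩
      refine h1 (Finset.card_eq_one.2 ⟨l.neg, ?_⟩)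
      ext c
      simp only [Finset.mem_filter, Finset.mem_singleton]
      constructor
      · rintro ⟨hc, hcm⟩
        have := (hD c hc).2.2 hcm
        rw [List.mem_append, List.mem_singleton] at this
        rcases this with hct | hcl
        · have h2 : lv c.1 ≤ k := h.level_le c.neg hct
          rw [hcm, ← hlm, hlev] at h2
          exact absurd (by exact_mod_cast h2) (Nat.not_succ_le_self k)
        · rw [← hcl]; simp [Lit.neg]
      · rintro rfl; exact ⟨hlD, hlm⟩
    have hn : ∀ W : Finset (Lit V), (∀ x ∈ T, lv x.1 ≤ m → (x ∈ W ↔ lv x.1 = m)) →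
        ¬ (l.neg ∈ D ∧ l ∈ W) := fun W hW hc =>
      hnot ⟨hc.1, (hW l (hT l (by simp)) (hD _ hc.1).2.1).1 hc.2⟩
    simp only [h1, if_false, hn U hU, hn U' hU']
    refine ih (fun x hx => hT x (by simp [hx])) D (fun c hc => ⟨(hD c hc).1, (hD c hc).2.1, ?_⟩) hex
    intro hcm
    have := (hD c hc).2.2 hcm
    rw [List.mem_append, List.mem_singleton] at this
    rcases this with hct | hcl
    · exact hct
    · refine absurd ⟨?_, ?_⟩ hnot
      · rw [← hcl]; simpa [Lit.neg] using hc
      · rw [← hcl]; exact hcm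
  | @imply t k l C h hrl hC hlev ih =>
    have hf : (D.filter fun c => c.neg ∈ U) = D.filter fun c => lv c.1 = m :=
      Finset.filter_congr fun c hc => hU _ (hD c hc).1 (hD c hc).2.1
    have hf' : (D.filter fun c => c.neg ∈ U') = D.filter fun c => lv c.1 = m :=
      Finset.filter_congr fun c hc => hU' _ (hD c hc).1 (hD c hc).2.1
    rw [List.reverse_append, List.reverse_singleton, List.singleton_append, uipLoop, uipLoop, hf,
      hf']
    by_cases h1 : (D.filter fun c => lv c.1 = m).card = 1
    · simp only [h1, if_true, and_true, true_and]
      exact fun c hc => ⟨(hD c hc).1, (hD c hc).2.1⟩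
    have hn : ∀ W : Finset (Lit V), (∀ x ∈ T, lv x.1 ≤ m → (x ∈ W ↔ lv x.1 = m)) →
        (l.neg ∈ D ∧ l ∈ W ↔ l.neg ∈ D ∧ lv l.1 = m) := fun W hW =>
      and_congr_right fun hc => hW l (hT l (by simp)) (hD _ hc).2.1
    have hT' : ∀ x ∈ t, x ∈ T := fun x hx => hT x (by simp [hx])
    have hsplit : ∀ c ∈ D, lv c.1 = m → c.neg ∈ t ∨ c = l.neg := by
      intro c hc hcm
      have := (hD c hc).2.2 hcm
      rw [List.mem_append, List.mem_singleton] at this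
      exact this.imp_right fun hcl => by rw [← hcl]; simp [Lit.neg]
    simp only [h1, if_false, hn U hU, hn U' hU']
    split_ifs with h2
    · rw [hrl]
      refine ih hT' _ (fun c hc => ?_) ?_
      · rw [resolve, Finset.mem_union] at hc
        rcases hc with hc | hc
        · rw [Finset.mem_erase] at hc
          exact ⟨(hD c hc.2).1, (hD c hc.2).2.1, fun hcm => (hsplit c hc.2 hcm).resolve_right hc.1⟩
        · refine ⟨hT' _ (hC c hc), ?_, fun _ => hC c hc⟩
          rw [← h2.2, hlev]
          exact Finset.le_sup (f := fun c : Lit V => lv c.1) hc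
      -- As `m > 0`, the reason has other literals, and one of them attains level `m`: the resolvent
      -- stays at that level.
      · have hne : (C.erase l).Nonempty := by
          rw [Finset.nonempty_iff_ne_empty]
          intro he
          rw [← h2.2, hlev, he] at hm
          simp at hm
        obtain ⟨c, hc, hce⟩ := Finset.exists_mem_eq_sup _ hne fun c : Lit V => lv c.1
        exact ⟨c, Finset.mem_union_right _ hc, by rw [← h2.2, hlev]; exact hce.symm⟩
    · refine ih hT' D (fun c hc => ⟨(hD c hc).1, (hD c hc).2.1, fun hcm => ?_⟩) hex
      refine (hsplit c hc hcm).resolve_right ?_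
      rintro rfl
      exact h2 ⟨hc, hcm⟩

end WellLeveled

/-- The invariant of the states of both solvers. -/
def Leveled (s : State V) : Prop := ∃ k, WellLeveled s.level s.reason s.trail k

variable {s : State V}

theorem leveled_init (F : CNF V) : (init F).Leveled := ⟨0, .nil⟩

theorem Falsified.neg_mem {C : Clause V} (h : s.Falsified C) : ∀ c ∈ C, c.neg ∈ s.trail := by
  intro c hc
  by_contra hn
  have : c ∈ s.rest C := Finset.mem_filter.2 ⟨hc, hn⟩
  rw [h] at this
  simp at this

theorem UnitIn.neg_mem {C : Clause V} {l : Lit V} (h : s.UnitIn C l) :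
    ∀ c ∈ C.erase l, c.neg ∈ s.trail := by
  intro c hc
  by_contra hn
  rw [Finset.mem_erase] at hc
  have : c ∈ s.rest C := Finset.mem_filter.2 ⟨hc.2, hn⟩
  rw [h, Finset.mem_singleton] at this
  exact hc.1 this

omit [DecidableEq V] in
theorem Unassigned.fst_ne {l : Lit V} (h : s.Unassigned l) : ∀ x ∈ s.trail, x.1 ≠ l.1 := by
  rintro ⟨v, a⟩ hx he
  obtain ⟨w, b⟩ := l
  obtain rfl : v = w := he
  cases a <;> cases b <;> simp_all [Unassigned, Lit.neg]

theorem Leveled.decideLit (h : s.Leveled) {l : Lit V} (hl : s.Unassigned l) :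
    (s.decideLit l).Leveled := by
  obtain ⟨k, hk⟩ := h
  have hne := hl.fst_ne
  refine ⟨k + 1, .decide l (hk.congr (fun x hx => ?_) fun x hx => ?_) ?_ ?_⟩
  · simp [State.decideLit, assign, hne x hx]
  · exact Function.update_of_ne (fun he => hne x hx (congrArg Prod.fst he)) _ _
  · simp [State.decideLit, assign]
  · have := hk.sup_level
    simp only [State.decideLit, assign, Function.update_self, levSet]
    exact congrArg (· + 1) this

theorem Leveled.imply (h : s.Leveled) {l : Lit V} (hl : s.Unassigned l) {C : Clause V}
    (hC : ∀ c ∈ C.erase l, c.neg ∈ s.trail) : (s.imply l C).Leveled := by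
  obtain ⟨k, hk⟩ := h
  have hne := hl.fst_ne
  refine ⟨k, .imply l C (hk.congr (fun x hx => ?_) fun x hx => ?_) ?_ hC ?_⟩
  · simp [State.imply, assign, hne x hx]
  · exact Function.update_of_ne (fun he => hne x hx (congrArg Prod.fst he)) _ _
  · simp [State.imply, assign]
  · simp only [State.imply, assign, Function.update_self, levSet]
    exact Finset.sup_congr rfl fun c hc =>
      (Function.update_of_ne (hne _ (hC c hc)) _ _).symm

theorem Leveled.undoLevel (h : s.Leveled) (b : ℕ∞) : (s.undoLevel b).Leveled := by
  obtain ⟨k, hk⟩ := h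
  obtain ⟨k', hk', -⟩ := hk.filter_level b
  refine ⟨k', hk'.congr (fun x hx => ?_) fun x hx => ?_⟩
  · rw [List.mem_filter, decide_eq_true_eq] at hx
    simp only [State.undoLevel]
    rw [if_neg]
    rintro ⟨y, hy, hyx, hby⟩
    rw [lev, hyx] at hby
    exact absurd hby (not_lt.2 hx.2)
  · rw [List.mem_filter, decide_eq_true_eq] at hx
    simp only [State.undoLevel]
    rw [if_neg]
    exact fun hc => absurd hc.2 (not_lt.2 hx.2)

theorem Leveled.levSet_ne_top (h : s.Leveled) {C : Clause V} (hC : ∀ c ∈ C, c.neg ∈ s.trail) :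
    s.levSet C ≠ ⊤ := by
  obtain ⟨k, hk⟩ := h
  exact ne_top_of_le_ne_top (ENat.natCast_ne_top k)
    (Finset.sup_le fun c hc => hk.level_le c.neg (hC c hc))

/-! ### Chunks and levels -/

theorem mem_chunk {d l : Lit V} :
    l ∈ s.chunk d ↔ l ∈ s.trail ∧ Relation.ReflTransGen s.Edge d l := by
  classical
  simp [chunk]

theorem mem_decisions {d : Lit V} : d ∈ s.decisions ↔ d ∈ s.trail ∧ s.reason d = none := by
  simp [decisions]

theorem Leveled.lev_le_of_reachable (h : s.Leveled) {d l : Lit V}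
    (hdl : Relation.ReflTransGen s.Edge d l) : s.lev d ≤ s.lev l := by
  obtain ⟨k, hk⟩ := h
  induction hdl with
  | refl => exact le_rfl
  | tail _ he ih =>
    obtain ⟨-, hl, C, hr, hc⟩ := he
    refine ih.trans ?_
    exact (Finset.le_sup (f := fun c : Lit V => s.level c.1) hc).trans
      (hk.reason_spec _ hl C hr).2.ge

/-- A decision has no incoming edges, so it lies in no chunk but its own. -/
theorem eq_of_reachable_decision {d l : Lit V} (hl : s.reason l = none)
    (hdl : Relation.ReflTransGen s.Edge d l) : d = l := by
  rcases hdl.cases_tail with he | ⟨x, -, -, -, C, hr, -⟩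
  · exact he.symm
  · simp [hl] at hr

/-- The decisions of level at least `m`, as a set of chunks. -/
noncomputable def decisionsFrom (s : State V) (m : ℕ∞) : Finset (Lit V) :=
  s.decisions.filter fun d => m ≤ s.lev d

/-- One inclusion is monotonicity of levels along edges, the other is `exists_decision`. Positivity
of `m` matters because literals of level `0` belong to no chunk. -/
theorem Leveled.chunkUnion_decisionsFrom (h : s.Leveled) {m : ℕ∞} (hm : 0 < m) :
    s.chunkUnion (s.decisionsFrom m) = s.trail.toFinset.filter fun l => m ≤ s.lev l := by
  ext l
  simp only [chunkUnion, decisionsFrom, Finset.mem_biUnion, Finset.mem_filter, mem_decisions,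
    mem_chunk, List.mem_toFinset]
  constructor
  · rintro ⟨d, ⟨-, hd⟩, hl, hdl⟩
    exact ⟨hl, hd.trans (h.lev_le_of_reachable hdl)⟩
  · rintro ⟨hl, hml⟩
    obtain ⟨k, hk⟩ := h
    obtain ⟨d, hd, hr, he, hdl⟩ := hk.exists_decision (fun x hx => hx) l hl (hm.trans_le hml)
    exact ⟨d, ⟨⟨hd, hr⟩, he ▸ hml⟩, hl, hdl⟩

/-- The set `G` can be read off as the decisions contained in the union. -/
theorem chunkUnion_injOn {G G' : Finset (Lit V)} (hG : G ⊆ s.decisions) (hG' : G' ⊆ s.decisions)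
    (h : s.chunkUnion G = s.chunkUnion G') : G = G' := by
  have key : ∀ H H' : Finset (Lit V), H ⊆ s.decisions → s.chunkUnion H = s.chunkUnion H' →
      H ⊆ H' := by
    intro H H' hH he d hd
    have hdd := mem_decisions.1 (hH hd)
    have : d ∈ s.chunkUnion H := Finset.mem_biUnion.2 ⟨d, hd, mem_chunk.2 ⟨hdd.1, .refl⟩⟩
    rw [he] at this
    obtain ⟨d', hd', hm⟩ := Finset.mem_biUnion.1 this
    rwa [← eq_of_reachable_decision hdd.2 (mem_chunk.1 hm).2]
  exact (key G G' hG h).antisymm (key G' G hG' h.symm)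

theorem mem_chunksOfClause {C : Clause V} {d : Lit V} :
    d ∈ s.chunksOfClause C ↔
      d ∈ s.decisions ∧ ∃ c ∈ C, c ∈ s.chunk d ∨ c.neg ∈ s.chunk d := by
  simp only [chunksOfClause, chunksOf, Finset.mem_biUnion, Finset.mem_filter]
  exact ⟨fun ⟨c, hc, hd, h⟩ => ⟨hd, c, hc, h⟩, fun ⟨hd, c, hc, h⟩ => ⟨c, hc, hd, h⟩⟩

theorem Leveled.lev_le_of_mem_chunksOfClause (h : s.Leveled) {C : Clause V} {d : Lit V}
    (hd : d ∈ s.chunksOfClause C) : s.lev d ≤ s.levSet C := by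
  obtain ⟨-, c, hc, hdc⟩ := mem_chunksOfClause.1 hd
  refine le_trans ?_ (Finset.le_sup (f := s.lev) hc)
  rcases hdc with hdc | hdc
  · exact h.lev_le_of_reachable (mem_chunk.1 hdc).2
  · exact h.lev_le_of_reachable (l := c.neg) (mem_chunk.1 hdc).2

/-! ### Candidates and the unique optimum -/

omit [DecidableEq V] in
theorem exists_lev_eq_levSet {C : Clause V} (h0 : 0 < s.levSet C) :
    ∃ c ∈ C, s.lev c = s.levSet C := by
  have hne : C.Nonempty := by
    rw [Finset.nonempty_iff_ne_empty]
    rintro rfl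
    simp [levSet] at h0
  obtain ⟨c, hc, he⟩ := Finset.exists_mem_eq_sup _ hne s.lev
  exact ⟨c, hc, he.symm⟩

/-- Chunks touching `C` have level at most `δ(C)`, so the intersection is the single decision of
level `δ(C)`. The second alternative in `IsCandidate` then holds, whether or not the learned clause
is new. -/
theorem Leveled.isCandidate_decisionsFrom (h : s.Leveled) {C : Clause V} (hC : s.Falsified C)
    (h0 : 0 < s.levSet C) : s.IsCandidate C (s.decisionsFrom (s.levSet C)) := by
  obtain ⟨c, hc, hce⟩ := exists_lev_eq_levSet h0
  obtain ⟨k, hk⟩ := id h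
  have hct := hC.neg_mem c hc
  obtain ⟨d, hd, hr, he, hdl⟩ := hk.exists_decision (fun x hx => hx) _ hct
    (show 0 < s.lev c by rwa [hce])
  have hdm : s.lev d = s.levSet C := he.trans hce
  have hG : s.decisionsFrom (s.levSet C) ∩ s.chunksOfClause C = {d} := by
    ext x
    simp only [Finset.mem_inter, Finset.mem_singleton, decisionsFrom, Finset.mem_filter]
    constructor
    · rintro ⟨⟨hx, hxm⟩, hxC⟩
      rw [mem_decisions] at hx
      refine hk.decision_unique x hx.1 d hd hx.2 hr ?_
      exact ((h.lev_le_of_mem_chunksOfClause hxC).antisymm hxm).trans hdm.symm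
    · rintro rfl
      have hxd := mem_decisions.2 ⟨hd, hr⟩
      exact ⟨⟨hxd, hdm.ge⟩,
        mem_chunksOfClause.2 ⟨hxd, c, hc, .inr (mem_chunk.2 ⟨hct, hdl⟩)⟩⟩
  refine ⟨Finset.filter_subset _ _, ?_, .inr ?_⟩
  · rw [hG, Finset.card_singleton]
  · rw [hG, levSet, Finset.sup_singleton, hdm]

/-- Supplies the guard `0 < δ(C)` that `CB` tests explicitly and `GB` does not: a candidate contains
a decision whose chunk touches `C`. -/
theorem Leveled.levSet_pos_of_isCandidate (h : s.Leveled) {C : Clause V} {G : Finset (Lit V)}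
    (hG : s.IsCandidate C G) : 0 < s.levSet C := by
  obtain ⟨d, hd⟩ := Finset.card_pos.1 (hG.2.1 ▸ Nat.one_pos)
  have hdC := (Finset.mem_inter.1 hd).2
  have hdd := mem_decisions.1 (mem_chunksOfClause.1 hdC).1
  refine lt_of_lt_of_le ?_ (h.lev_le_of_mem_chunksOfClause hdC)
  exact h.elim fun k hk => hk.level_pos_of_decision d hdd.1 hdd.2

omit [DecidableEq V] in
theorem sum_zetaCB (C : Clause V) (U : Finset (Lit V)) :
    ∑ l ∈ U, zetaCB s C l =
      ((U.filter fun l => ¬ s.levSet C ≤ s.lev l).card : ℝ) -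
        (U.filter fun l => s.levSet C ≤ s.lev l).card := by
  simp only [zetaCB, Finset.sum_ite, Finset.sum_const, nsmul_eq_mul]
  ring

theorem chunkUnion_subset (G : Finset (Lit V)) : s.chunkUnion G ⊆ s.trail.toFinset :=
  Finset.biUnion_subset.2 fun _ _ _ hl => List.mem_toFinset.2 (mem_chunk.1 hl).1

theorem Leveled.isOptimal_iff (h : s.Leveled) {C : Clause V} (hC : s.Falsified C)
    (h0 : 0 < s.levSet C) (G : Finset (Lit V)) :
    s.IsOptimal (zetaCB s C) C G ↔ G = s.decisionsFrom (s.levSet C) := by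
  set A := s.trail.toFinset.filter fun l => s.levSet C ≤ s.lev l with hA
  have hU : s.chunkUnion (s.decisionsFrom (s.levSet C)) = A := h.chunkUnion_decisionsFrom h0
  have hcand := h.isCandidate_decisionsFrom hC h0
  have hsumA : ∑ l ∈ A, zetaCB s C l = -(A.card : ℝ) := by
    rw [sum_zetaCB, hA, Finset.filter_filter, Finset.filter_filter]
    simp
  have hsub : ∀ H : Finset (Lit V),
      ((s.chunkUnion H).filter fun l => s.levSet C ≤ s.lev l) ⊆ A := fun H =>
    Finset.filter_subset_filter _ (chunkUnion_subset H)
  constructor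
  · rintro ⟨hG, hmin⟩
    have hle := hmin _ hcand
    rw [hU, hsumA, sum_zetaCB] at hle
    have hcard := Finset.card_le_card (hsub G)
    -- With `U` the union of `G`, optimality gives `|U \ A| + |A| ≤ |U ∩ A| ≤ |A|`, which forces `U
    -- \ A = ∅` and `U ∩ A = A`.
    have hle' : ((s.chunkUnion G).filter fun l => ¬ s.levSet C ≤ s.lev l).card + A.card ≤
        ((s.chunkUnion G).filter fun l => s.levSet C ≤ s.lev l).card := by
      have : (((s.chunkUnion G).filter fun l => ¬ s.levSet C ≤ s.lev l).card : ℝ) + A.card ≤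
        ((s.chunkUnion G).filter fun l => s.levSet C ≤ s.lev l).card := by linarith
      exact_mod_cast this
    have heq := Finset.eq_of_subset_of_card_le (hsub G) (by omega)
    have hemp : ((s.chunkUnion G).filter fun l => ¬ s.levSet C ≤ s.lev l) = ∅ :=
      Finset.card_eq_zero.1 (by omega)
    refine chunkUnion_injOn hG.1 hcand.1 ?_
    rw [hU, ← heq, ← Finset.filter_union_filter_not_eq (fun l => s.levSet C ≤ s.lev l)
      (s.chunkUnion G), hemp, Finset.union_empty, Finset.filter_filter]
    simp
  · rintro rfl
    refine ⟨hcand, fun G' _ => ?_⟩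
    rw [hU, hsumA, sum_zetaCB]
    have hcard : (((s.chunkUnion G').filter fun l => s.levSet C ≤ s.lev l).card : ℝ) ≤ A.card := by
      exact_mod_cast Finset.card_le_card (hsub G')
    have : (0 : ℝ) ≤ ((s.chunkUnion G').filter fun l => ¬ s.levSet C ≤ s.lev l).card :=
      Nat.cast_nonneg _
    linarith

/-! ### The learned clause -/

theorem Leveled.uip_spec (h : s.Leveled) {C : Clause V} (hC : s.Falsified C)
    (h0 : 0 < s.levSet C) :
    s.uipChunks (s.decisionsFrom (s.levSet C)) C = s.uipLevel C ∧
      (∀ c ∈ s.uipLevel C, c.neg ∈ s.trail ∧ s.lev c ≤ s.levSet C) ∧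
      ((s.uipLevel C).filter fun c => s.lev c = s.levSet C).card = 1 := by
  obtain ⟨k, hk⟩ := id h
  rw [uipChunks, h.chunkUnion_decisionsFrom h0]
  refine hk.uipLoop_spec h0 (T := s.trail) (fun x hx hle => ?_) (fun x hx hle => ?_)
    (fun x hx => hx) C (fun c hc => ?_) (exists_lev_eq_levSet h0)
  · rw [Finset.mem_filter, List.mem_toFinset]
    exact ⟨fun hc => hc.2, fun he => ⟨hx, he⟩⟩
  · rw [Finset.mem_filter, List.mem_toFinset]
    exact ⟨fun hc => hle.antisymm hc.2, fun he => ⟨hx, he.ge⟩⟩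
  · exact ⟨hC.neg_mem c hc, Finset.le_sup (f := s.lev) hc, fun _ => hC.neg_mem c hc⟩

/-- Identifies the backtrack level `δ(D) - 1` of `CB` with `δ(C) - 1`. -/
theorem Leveled.levSet_uipLevel (h : s.Leveled) {C : Clause V} (hC : s.Falsified C)
    (h0 : 0 < s.levSet C) : s.levSet (s.uipLevel C) = s.levSet C := by
  obtain ⟨-, hle, hcard⟩ := h.uip_spec hC h0
  obtain ⟨c, hc⟩ := Finset.card_pos.1 (hcard ▸ Nat.one_pos)
  rw [Finset.mem_filter] at hc
  exact le_antisymm (Finset.sup_le fun c hc => (hle c hc).2)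
    (hc.2 ▸ Finset.le_sup (f := s.lev) hc.1)

/-! ### Backtracking -/

/-- Both hypotheses exclude real exceptions: in `ℕ∞`, `0 - 1 = 0` and `⊤ - 1 = ⊤`. -/
theorem le_sub_one_iff_not_le {m n : ℕ∞} (hm : 0 < m) (hm' : m ≠ ⊤) : n ≤ m - 1 ↔ ¬ m ≤ n := by
  lift m to ℕ using hm'
  have hm1 : 0 < m := by exact_mod_cast hm
  have : ((m : ℕ∞) - 1) = ((m - 1 : ℕ) : ℕ∞) := by push_cast; rfl
  rw [this, not_le]
  induction n using ENat.recTopCoe with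
  | top => simp
  | coe n =>
    rw [Nat.cast_le, Nat.cast_lt]
    omega

theorem Leveled.undoChunks_decisionsFrom (h : s.Leveled) {m : ℕ∞} (hm : 0 < m) (hm' : m ≠ ⊤) :
    s.undoChunks (s.decisionsFrom m) = s.undoLevel (m - 1) := by
  have hU : ∀ l, l ∈ s.chunkUnion (s.decisionsFrom m) ↔ l ∈ s.trail ∧ m - 1 < s.lev l := by
    intro l
    rw [h.chunkUnion_decisionsFrom hm, Finset.mem_filter, List.mem_toFinset, ← not_le,
      le_sub_one_iff_not_le hm hm', not_not]
  have htrail : (s.trail.filter fun l => l ∉ s.chunkUnion (s.decisionsFrom m)) =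
      s.trail.filter fun l => s.lev l ≤ m - 1 := by
    refine List.filter_congr fun l hl => ?_
    simp only [hU, hl, true_and, not_lt]
  have hlevel : (fun v => if ∃ l ∈ s.chunkUnion (s.decisionsFrom m), l.1 = v then ⊤
      else s.level v) = (s.undoLevel (m - 1)).level := by
    funext v
    simp only [State.undoLevel]
    refine if_congr ?_ rfl rfl
    constructor
    · rintro ⟨l, hl, hv⟩
      exact ⟨l, ((hU l).1 hl).1, hv, ((hU l).1 hl).2⟩
    · rintro ⟨l, hl, hv, hb⟩
      exact ⟨l, (hU l).2 ⟨hl, hb⟩, hv⟩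
  obtain ⟨k, hk⟩ := h.undoLevel (m - 1)
  refine State.ext htrail ?_ ?_ rfl
  · change relevel s.reason (s.trail.filter fun l => l ∉ s.chunkUnion (s.decisionsFrom m)) 0 (fun v =>
      if ∃ l ∈ s.chunkUnion (s.decisionsFrom m), l.1 = v then ⊤ else s.level v) = _
    rw [hlevel, htrail]
    -- `relevel` reads the old reasons, which agree with the new ones on the literals that are kept.
    refine (hk.congr (fun _ _ => rfl) fun x hx => ?_).relevel_eq
    have hx' := (List.mem_filter.1 hx).2
    rw [decide_eq_true_eq] at hx'
    simp only [State.undoLevel]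
    rw [if_neg fun hc => absurd hc.2 (not_lt.2 hx')]
  · funext l
    change (if l ∈ s.chunkUnion (s.decisionsFrom m) then none else s.reason l) = _
    exact if_congr (hU l) rfl rfl

/-- After chronological backtracking the learned clause is unit. -/
theorem Leveled.neg_mem_undoLevel (h : s.Leveled) {C : Clause V} (hC : s.Falsified C)
    (h0 : 0 < s.levSet C) {l : Lit V} (hl : l ∈ s.uipLevel C)
    (hu : (s.undoLevel (s.levSet C - 1)).Unassigned l) :
    ∀ c ∈ (s.uipLevel C).erase l, c.neg ∈ (s.undoLevel (s.levSet C - 1)).trail := by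
  obtain ⟨-, hle, hcard⟩ := h.uip_spec hC h0
  have htop := h.levSet_ne_top hC.neg_mem
  have key : ∀ c ∈ s.uipLevel C, s.lev c ≠ s.levSet C →
      c.neg ∈ (s.undoLevel (s.levSet C - 1)).trail := by
    intro c hc hne
    refine List.mem_filter.2 ⟨(hle c hc).1, decide_eq_true ?_⟩
    rw [le_sub_one_iff_not_le h0 htop]
    exact fun hge => hne ((hle c hc).2.antisymm hge)
  -- All literals below level `δ(C)` stay falsified, so the unassigned `l` is the UIP literal.
  have hlm : s.lev l = s.levSet C := by
    by_contra hne
    exact hu.2 (key l hl hne)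
  intro c hc
  rw [Finset.mem_erase] at hc
  refine key c hc.2 fun hcm => hc.1 ?_
  exact Finset.card_le_one.1 hcard.le c (Finset.mem_filter.2 ⟨hc.2, hcm⟩) l
    (Finset.mem_filter.2 ⟨hl, hlm⟩)

end State

/-! ### The simulation -/

section Simulation

variable {V : Type*} [DecidableEq V]

open State

/-- Corresponding configurations of chronological and of graph backtracking. -/
inductive Corresponds : Config V ℕ∞ → Config V (Finset (Lit V)) → Prop
  | search (s : State V) (h : s.Leveled) : Corresponds ⟨s, .search⟩ ⟨s, .search⟩
  | conflict (s : State V) (C : Clause V) (h : s.Leveled) (hC : s.Falsified C) :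
      Corresponds ⟨s, .conflict C⟩ ⟨s, .conflict C⟩
  | analyzed (s : State V) (C D : Clause V) (b : ℕ∞) (G : Finset (Lit V)) (h : s.Leveled)
      (hC : s.Falsified C) (h0 : 0 < s.levSet C) (hD : D = s.uipLevel C)
      (hb : b = s.levSet C - 1) (hG : G = s.decisionsFrom (s.levSet C)) :
      Corresponds ⟨s.learn D, .analyzed b D⟩ ⟨s.learn D, .analyzed G D⟩
  | undone (s : State V) (D : Clause V) (h : s.Leveled)
      (hD : ∀ l ∈ D, s.Unassigned l → ∀ c ∈ D.erase l, c.neg ∈ s.trail) :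
      Corresponds ⟨s, .undone D⟩ ⟨s, .undone D⟩

theorem Corresponds.state_eq {c : Config V ℕ∞} {g : Config V (Finset (Lit V))}
    (h : Corresponds c g) : c.state = g.state := by
  cases h <;> rfl

theorem corresponds_start (F : CNF V) : Corresponds (start V ℕ∞ F) (start V _ F) :=
  .search _ (leveled_init F)

theorem corresponds_undo {s : State V} {C : Clause V} (h : s.Leveled) (hC : s.Falsified C)
    (h0 : 0 < s.levSet C) :
    Corresponds
      ⟨CB.undo (s.learn (s.uipLevel C)) (s.levSet C - 1), .undone (s.uipLevel C)⟩
      ⟨(GB zetaCB).undo (s.learn (s.uipLevel C)) (s.decisionsFrom (s.levSet C)),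
        .undone (s.uipLevel C)⟩ := by
  -- Learning changes only the clause set, which the invariant does not mention.
  have hL : (s.learn (s.uipLevel C)).Leveled := h
  have he : (GB zetaCB).undo (s.learn (s.uipLevel C)) (s.decisionsFrom (s.levSet C)) =
      CB.undo (s.learn (s.uipLevel C)) (s.levSet C - 1) :=
    hL.undoChunks_decisionsFrom h0 (h.levSet_ne_top hC.neg_mem)
  rw [he]
  exact .undone _ _ (hL.undoLevel _) fun l hl hu => h.neg_mem_undoLevel hC h0 hl hu

theorem Corresponds.exists_step_gb {c c' : Config V ℕ∞} {g : Config V (Finset (Lit V))}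
    (h : Corresponds c g) (hs : Step CB c c') :
    ∃ g', Step (GB zetaCB) g g' ∧ Corresponds c' g' := by
  cases h with
  | search s h =>
    cases hs with
    | decide _ l hsat hl => exact ⟨_, .decide s l hsat hl, .search _ (h.decideLit hl)⟩
    | propagate _ C l hC hl hu =>
      exact ⟨_, .propagate s C l hC hl hu, .search _ (h.imply hl hu.neg_mem)⟩
    | conflict _ C hC hf => exact ⟨_, .conflict s C hC hf, .conflict s C h hf⟩
  | conflict s C h hC =>
    cases hs with
    | analyze _ _ D b hA =>
      obtain ⟨h0, hD, hb⟩ := hA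
      rw [hD, h.levSet_uipLevel hC h0] at hb
      exact ⟨_, .analyze s C D _ ⟨(h.isOptimal_iff hC h0 _).2 rfl,
        hD.trans (h.uip_spec hC h0).1.symm⟩, .analyzed s C D b _ h hC h0 hD hb rfl⟩
  | analyzed s C D b G h hC h0 hD hb hG =>
    cases hs with
    | backtrack =>
      subst hD hb hG
      exact ⟨_, .backtrack _ _ _, corresponds_undo h hC h0⟩
  | undone s D h hD =>
    cases hs with
    | flip _ _ l hl hu => exact ⟨_, .flip s D l hl hu, .search _ (h.imply hu (hD l hl hu))⟩

theorem Corresponds.exists_step_cb {c : Config V ℕ∞} {g g' : Config V (Finset (Lit V))}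
    (h : Corresponds c g) (hs : Step (GB zetaCB) g g') :
    ∃ c', Step CB c c' ∧ Corresponds c' g' := by
  cases h with
  | search s h =>
    cases hs with
    | decide _ l hsat hl => exact ⟨_, .decide s l hsat hl, .search _ (h.decideLit hl)⟩
    | propagate _ C l hC hl hu =>
      exact ⟨_, .propagate s C l hC hl hu, .search _ (h.imply hl hu.neg_mem)⟩
    | conflict _ C hC hf => exact ⟨_, .conflict s C hC hf, .conflict s C h hf⟩
  | conflict s C h hC =>
    cases hs with
    | analyze _ _ D G hA =>
      obtain ⟨hopt, hD⟩ := hA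
      have h0 := h.levSet_pos_of_isCandidate hopt.1
      have hG := (h.isOptimal_iff hC h0 G).1 hopt
      rw [hG, (h.uip_spec hC h0).1] at hD
      exact ⟨_, .analyze s C D _ ⟨h0, hD, rfl⟩, .analyzed s C D _ G h hC h0 hD
        (by rw [hD, h.levSet_uipLevel hC h0]) hG⟩
  | analyzed s C D b G h hC h0 hD hb hG =>
    cases hs with
    | backtrack =>
      subst hD hb hG
      exact ⟨_, .backtrack _ _ _, corresponds_undo h hC h0⟩
  | undone s D h hD =>
    cases hs with
    | flip _ _ l hl hu => exact ⟨_, .flip s D l hl hu, .search _ (h.imply hu (hD l hl hu))⟩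

end Simulation

section Transfer

variable {V : Type*} [DecidableEq V] {β γ : Type*} {A : Scheme V β} {B : Scheme V γ}
  {R : Config V β → Config V γ → Prop}

/-- A one-way simulation suffices here; taking `Corresponds` and its converse as `R` gives the two
directions. -/
theorem exists_chain_of_simulation (hstate : ∀ a b, R a b → a.state = b.state)
    (hstep : ∀ a b a', R a b → Step A a a' → ∃ b', Step B b b' ∧ R a' b')
    (as : List (Config V β)) (a : Config V β) (b : Config V γ) (hab : R a b)
    (hc : (a :: as).IsChain (Step A)) :
    ∃ bs : List (Config V γ), (b :: bs).IsChain (Step B) ∧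
      (a :: as).map Config.state = (b :: bs).map Config.state := by
  induction as generalizing a b with
  | nil => exact ⟨[], by simp, by simp [hstate a b hab]⟩
  | cons a' as ih =>
    rw [List.isChain_cons_cons] at hc
    obtain ⟨b', hb', hR⟩ := hstep a b a' hab hc.1
    obtain ⟨bs, hbs, he⟩ := ih a' b' hR hc.2
    refine ⟨b' :: bs, List.isChain_cons_cons.2 ⟨hb', hbs⟩, ?_⟩
    rw [List.map_cons, he, hstate a b hab]
    rfl

theorem IsTrace.of_simulation {F : CNF V} {t : List (State V)} (ht : IsTrace A F t)
    (hstate : ∀ a b, R a b → a.state = b.state)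
    (hstep : ∀ a b a', R a b → Step A a a' → ∃ b', Step B b b' ∧ R a' b')
    (hstart : R (start V β F) (start V γ F)) : IsTrace B F t := by
  obtain ⟨cs, hcs, rfl⟩ := ht
  exact exists_chain_of_simulation hstate hstep cs _ _ hstart hcs

theorem ReachableConfig.of_simulation {F : CNF V} {a : Config V β} (ha : ReachableConfig A F a)
    (hstep : ∀ a b a', R a b → Step A a a' → ∃ b', Step B b b' ∧ R a' b')
    (hstart : R (start V β F) (start V γ F)) : ∃ b, ReachableConfig B F b ∧ R a b := by
  induction ha with
  | refl => exact ⟨_, .refl, hstart⟩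
  | tail _ hs ih =>
    obtain ⟨b, hb, hR⟩ := ih
    obtain ⟨b', hb', hR'⟩ := hstep _ _ _ hR hs
    exact ⟨b', hb.tail hb', hR'⟩

theorem Reachable.of_simulation {F : CNF V} {s : State V} (hs : Reachable A F s)
    (hstate : ∀ a b, R a b → a.state = b.state)
    (hstep : ∀ a b a', R a b → Step A a a' → ∃ b', Step B b b' ∧ R a' b')
    (hstart : R (start V β F) (start V γ F)) : Reachable B F s := by
  obtain ⟨p, hp⟩ := hs
  obtain ⟨⟨s', q⟩, hb, hR⟩ := hp.of_simulation hstep hstart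
  obtain rfl : s = s' := hstate _ _ hR
  exact ⟨q, hb⟩

end Transfer

end SAT

theorem theorem2 {V : Type*} [DecidableEq V] (F : SAT.CNF V) :
    -- both solvers have the same sequences of solver states
    (∀ t : List (SAT.State V), SAT.IsTrace (SAT.GB SAT.zetaCB) F t ↔ SAT.IsTrace SAT.CB F t) ∧
    -- in particular, they reach the same solver states
    (∀ s : SAT.State V, SAT.Reachable (SAT.GB SAT.zetaCB) F s ↔ SAT.Reachable SAT.CB F s) ∧
    -- the optimal chunk set for every conflict that is not at level zero
    (∀ (s : SAT.State V) (C : SAT.Clause V),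
      SAT.ReachableConfig (SAT.GB SAT.zetaCB) F ⟨s, .conflict C⟩ → 0 < s.levSet C →
      ∃ G : Finset (SAT.Lit V),
        (∀ G' : Finset (SAT.Lit V), s.IsOptimal (SAT.zetaCB s C) C G' ↔ G' = G) ∧
        G = s.decisions.filter (fun d => s.levSet C ≤ s.lev d) ∧
        s.chunkUnion G = s.trail.toFinset.filter (fun l => s.levSet C ≤ s.lev l) ∧
        s.uipChunks G C = s.uipLevel C) := by
  have hcb := fun (g : SAT.Config V (Finset (SAT.Lit V))) (c : SAT.Config V ℕ∞)
    (g' : SAT.Config V (Finset (SAT.Lit V))) (h : SAT.Corresponds c g)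
    (hs : SAT.Step (SAT.GB SAT.zetaCB) g g') => h.exists_step_cb hs
  have hgb := fun (c : SAT.Config V ℕ∞) (g : SAT.Config V (Finset (SAT.Lit V)))
    (c' : SAT.Config V ℕ∞) (h : SAT.Corresponds c g)
    (hs : SAT.Step SAT.CB c c') => h.exists_step_gb hs
  have hst := SAT.corresponds_start F
  refine ⟨fun t => ⟨fun h => ?_, fun h => ?_⟩, fun s => ⟨fun h => ?_, fun h => ?_⟩,
    fun s C hr h0 => ?_⟩
  · exact h.of_simulation (R := fun g c => SAT.Corresponds c g) (fun _ _ h => h.state_eq.symm)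
      hcb hst
  · exact h.of_simulation (fun _ _ h => h.state_eq) hgb hst
  · exact h.of_simulation (R := fun g c => SAT.Corresponds c g) (fun _ _ h => h.state_eq.symm)
      hcb hst
  · exact h.of_simulation (fun _ _ h => h.state_eq) hgb hst
  -- The simulation relation doubles as an invariant: it yields that the reached state is
  -- well-levelled and falsifies `C`.
  · obtain ⟨c, -, hR⟩ := hr.of_simulation (R := fun g c => SAT.Corresponds c g) hcb hst
    cases hR with
    | conflict _ _ h hC =>
      exact ⟨s.decisionsFrom (s.levSet C), h.isOptimal_iff hC h0, rfl,
        h.chunkUnion_decisionsFrom h0, (h.uip_spec hC h0).1⟩
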